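/- Let $\mathbb F_q$ be the finite field with $q$ elements, let $m\ge 1$, let $w=(w_0,w_1,\dots,w_m)$ be positive integers with $w_1\le w_2\le\dots\le w_m$ (no relation between $w_0$ and the other weights is required), and let $d\ge 0$ be an integer. Let $\mathbb P(w)=(\overline{\mathbb F_q}^{\,m+1}\setminus\{0\})/\overline{\mathbb F_q}^{\,*}$, where $\lambda\cdot(x_0,\dots,x_m)=(\lambda^{w_0}x_0,\dots,\lambda^{w_m}x_m)$, and let $\mathbb P(w)(\mathbb F_q)$ be the set of points of $\mathbb P(w)$ fixed by the Frobenius map $(x_0:\dots:x_m)\mapsto(x_0^q:\dots:x_m^q)$. Let $e_q(d;w_0,\dots,w_m)$ be the maximal number of points of $\mathbb P(w)(\mathbb F_q)$ at which $f$ vanishes, as $f$ runs over the nonzero polynomials in $\mathbb F_q[x_0,\dots,x_m]$ that are weighted homogeneous of degree $d$ with $\deg x_i=w_i$ (with $e_q=0$ if there is no such $f$). Put $p_k=\frac{q^{k+1}-1}{q-1}$ for integers $k\ge -1$; in particular $p_{-1}=0$. If $\gcd(w_0,w_i,q-1)=1$ for all $1\le i\le m$, then $$e_q(d;w_0,w_1,\dots,w_m)\le\min\left\{p_m,\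 \left(\left\lfloor\frac{d-1}{w_1}\right\rfloor+1\right)q^{m-1}+p_{m-2}\right\}.$$ -/

import Mathlib

open MvPolynomial

namespace WeightedProj

/-- Nonzero vectors with `m + 1` coordinates in the algebraic closure of `F`. -/
abbrev Punctured (F : Type*) [Field F] (m : ℕ) : Type _ :=
  {x : Fin (m + 1) → AlgebraicClosure F // x ≠ 0}

/-- Two nonzero vectors are equivalent when some `t ≠ 0` in the algebraic closure satisfies
`y i = t ^ (w i) * x i` for all `i`: the orbit relation of the weighted action. -/
def orbitSetoid (F : Type*) [Field F] {m : ℕ} (w : Fin (m + 1) → ℕ) :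
    Setoid (Punctured F m) where
  r x y := ∃ t : (AlgebraicClosure F)ˣ, ∀ i, y.1 i = (t : AlgebraicClosure F) ^ w i * x.1 i
  iseqv :=
    { refl := fun x => ⟨1, fun i => by simp⟩
      symm := by
        rintro x y ⟨t, ht⟩
        refine ⟨t⁻¹, fun i => ?_⟩
        rw [ht i, ← mul_assoc, ← mul_pow]
        simp
      trans := by
        rintro x y z ⟨s, hs⟩ ⟨t, ht⟩
        refine ⟨t * s, fun i => ?_⟩
        rw [ht i, hs i, Units.val_mul, mul_pow, mul_assoc] }

/-- The weighted projective space of weight `w` (its set of geometric points). -/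
def Space (F : Type*) [Field F] {m : ℕ} (w : Fin (m + 1) → ℕ) : Type _ :=
  Quotient (orbitSetoid F w)

/-- The point of the weighted projective space with homogeneous coordinates `x`. -/
def Space.mk {F : Type*} [Field F] {m : ℕ} (w : Fin (m + 1) → ℕ) (x : Punctured F m) :
    Space F w :=
  Quotient.mk (orbitSetoid F w) x

/-- The `q`-power Frobenius on nonzero vectors, coordinate by coordinate. -/
noncomputable def frobVec {F : Type*} [Field F] [Fintype F] {m : ℕ} (x : Punctured F m) : Punctured F m :=
  ⟨fun i => x.1 i ^ Fintype.card F, fun h => x.2 <| funext fun i =>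
    pow_eq_zero_iff Fintype.card_ne_zero |>.1 (congrFun h i)⟩

/-- The `q`-power Frobenius on the weighted projective space. -/
noncomputable def frob {F : Type*} [Field F] [Fintype F] {m : ℕ} (w : Fin (m + 1) → ℕ) :
    Space F w → Space F w :=
  Quotient.map frobVec (by
    rintro x y ⟨t, ht⟩
    refine ⟨t ^ Fintype.card F, fun i => ?_⟩
    simp only [frobVec, ht i, mul_pow, Units.val_pow_eq_pow_val]
    rw [pow_right_comm])

/-- The rational points: those fixed by the Frobenius. -/
def rationalPoints (F : Type*) [Field F] [Fintype F] {m : ℕ} (w : Fin (m + 1) → ℕ) :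
    Set (Space F w) :=
  {P | frob w P = P}

/-- `f` vanishes at `P`: it vanishes at the homogeneous coordinates of `P`
(for weighted homogeneous `f` the choice of coordinates is irrelevant, see `vanishesAt_mk`). -/
def VanishesAt {F : Type*} [Field F] {m : ℕ} {w : Fin (m + 1) → ℕ}
    (f : MvPolynomial (Fin (m + 1)) F) (P : Space F w) : Prop :=
  ∀ x : Punctured F m, Space.mk w x = P → aeval x.1 f = 0

/-- The set of rational points at which `f` vanishes. -/
def rationalZeros {F : Type*} [Field F] [Fintype F] {m : ℕ} (w : Fin (m + 1) → ℕ)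
    (f : MvPolynomial (Fin (m + 1)) F) : Set (Space F w) :=
  {P | P ∈ rationalPoints F w ∧ VanishesAt f P}

/-- The numbers of rational zeros of the nonzero weighted homogeneous polynomials of degree `d`
for the weights `w`. -/
def zeroCounts (F : Type*) [Field F] [Fintype F] {m : ℕ} (d : ℕ) (w : Fin (m + 1) → ℕ) : Set ℕ :=
  {N | ∃ f ∈ weightedHomogeneousSubmodule F w d, f ≠ 0 ∧ N = (rationalZeros w f).ncard}

/-- The maximal number `e_q(d; w_0, …, w_m)` of rational zeros of a nonzero weighted homogeneous
polynomial of degree `d` (a genuine maximum by `isGreatest_maxZeros`; it is `0` when there is no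
such polynomial). -/
noncomputable def maxZeros (F : Type*) [Field F] [Fintype F] {m : ℕ} (d : ℕ)
    (w : Fin (m + 1) → ℕ) : ℕ :=
  sSup (zeroCounts F d w)

/-- `p_k = (q ^ (k + 1) - 1) / (q - 1)`, for an integer index `k` (so `p_{-1} = 0`). -/
def projCard (q : ℕ) (k : ℤ) : ℚ :=
  ((q : ℚ) ^ (k + 1) - 1) / ((q : ℚ) - 1)

theorem aeval_smul {F : Type*} [Field F] {m d : ℕ} {w : Fin (m + 1) → ℕ}
    {f : MvPolynomial (Fin (m + 1)) F} (hf : IsWeightedHomogeneous w f d)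
    (t : AlgebraicClosure F) (x : Fin (m + 1) → AlgebraicClosure F) :
    aeval (fun i => t ^ w i * x i) f = t ^ d * aeval x f := by
  rw [aeval_def, aeval_def, eval₂_eq', eval₂_eq', Finset.mul_sum]
  refine Finset.sum_congr rfl fun s hs => ?_
  have h := hf (mem_support_iff.1 hs)
  rw [Finsupp.weight_apply, Finsupp.sum_fintype _ _ (by simp)] at h
  simp only [mul_pow, Finset.prod_mul_distrib, ← pow_mul, Finset.prod_pow_eq_pow_sum]
  rw [← h]
  simp only [smul_eq_mul, mul_comm]
  ring

/-- For weighted homogeneous `f`, vanishing can be tested on any homogeneous coordinates. -/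
theorem vanishesAt_mk {F : Type*} [Field F] {m d : ℕ} {w : Fin (m + 1) → ℕ}
    {f : MvPolynomial (Fin (m + 1)) F} (hf : IsWeightedHomogeneous w f d) (x : Punctured F m) :
    VanishesAt f (Space.mk w x) ↔ aeval x.1 f = 0 := by
  refine ⟨fun h => h x rfl, fun h y hy => ?_⟩
  obtain ⟨t, ht⟩ := (orbitSetoid F w).symm (Quotient.exact hy)
  rw [show y.1 = fun i => (t : AlgebraicClosure F) ^ w i * x.1 i from funext ht,
    aeval_smul hf, h, mul_zero]

/-- There are finitely many rational points. -/
theorem finite_rationalPoints (F : Type*) [Field F] [Fintype F] {m : ℕ} (w : Fin (m + 1) → ℕ) :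
    (rationalPoints F w).Finite := by
  classical
  set q := Fintype.card F with hq
  have hq1 : 1 < q := Fintype.one_lt_card
  have hS : {a : AlgebraicClosure F | a ^ q = a}.Finite := by
    refine ((Polynomial.X ^ q - Polynomial.X :
      Polynomial (AlgebraicClosure F)).roots.toFinset.finite_toSet).subset fun a ha => ?_
    have ha' : a ^ q = a := ha
    simp [Polynomial.mem_roots (FiniteField.X_pow_card_sub_X_ne_zero (AlgebraicClosure F) hq1),
      ha']
  have hT : {x : Punctured F m | ∀ i, x.1 i ^ q = x.1 i}.Finite := by
    refine Set.Finite.of_finite_image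
      (f := fun x : Punctured F m => x.1) ?_ Subtype.val_injective.injOn
    refine (Set.Finite.pi' fun _ : Fin (m + 1) => hS).subset ?_
    rintro _ ⟨x, hx, rfl⟩
    exact hx
  refine (hT.image (Space.mk w)).subset fun P hP => ?_
  induction P using Quotient.inductionOn with
  | h x =>
    obtain ⟨t, ht⟩ := Quotient.exact (show Space.mk w (frobVec x) = Space.mk w x from hP)
    obtain ⟨s, hs⟩ := IsAlgClosed.exists_pow_nat_eq (t : AlgebraicClosure F)
      (show 0 < q - 1 by omega)
    have hs0 : s ≠ 0 := by
      rintro rfl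
      rw [zero_pow (by omega)] at hs
      exact t.ne_zero hs.symm
    have hsq : s ^ q = t * s := by
      rw [← hs, ← pow_succ]
      congr 1
      omega
    have key : ∀ i, (s ^ w i * x.1 i) ^ q = s ^ w i * x.1 i := fun i => by
      have h : x.1 i = (t : AlgebraicClosure F) ^ w i * x.1 i ^ q := ht i
      rw [mul_pow, pow_right_comm, hsq, mul_pow]
      conv_rhs => rw [h]
      ring
    refine ⟨⟨fun i => s ^ w i * x.1 i, fun h => x.2 <| funext fun i => ?_⟩, key, ?_⟩
    · simpa [hs0] using congrFun h i
    · exact (Quotient.sound ⟨Units.mk0 s hs0, fun i => rfl⟩ : Space.mk w x = _).symm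

/-- `maxZeros` is attained as soon as there is a nonzero polynomial of the given degree. -/
theorem isGreatest_maxZeros (F : Type*) [Field F] [Fintype F] {m : ℕ} (d : ℕ)
    (w : Fin (m + 1) → ℕ) (h : weightedHomogeneousSubmodule F w d ≠ ⊥) :
    IsGreatest (zeroCounts F d w) (maxZeros F d w) := by
  have hb : BddAbove (zeroCounts F d w) := by
    refine ⟨(rationalPoints F w).ncard, ?_⟩
    rintro _ ⟨f, -, -, rfl⟩
    exact Set.ncard_le_ncard (fun P hP => hP.1) (finite_rationalPoints F w)
  obtain ⟨f, hf, hf0⟩ := (Submodule.ne_bot_iff _).1 h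
  exact ⟨Nat.sSup_mem ⟨_, f, hf, hf0, rfl⟩ hb, fun N hN => le_csSup hb hN⟩

end WeightedProj

/-!
Rational points are replaced by vectors over `F`. Every rational point has coordinates in `F`, and
at least `q - 1` different coordinate vectors in `F` (`exists_rep_of_mem_rationalPoints`,
`exists_injective_rep`), so `(q - 1) * #zeros + 1` is at most the number of zeros of `f` in
`F ^ (m + 1)` when `d > 0`; for `d = 0` there are no zeros. With `D = ⌈d / w 1⌉` it remains to show that the latter is at most
`q ^ (m - 1) * (1 + (q - 1) * D)`.

For `a ≠ 0` the polynomial `P = f (a, ·)` is nonzero, has weighted degree at most `d`, and its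
component of degree `d` is `T = f (0, ·)`, whatever `a` is. So it is enough to prove, for every
nonzero `P` in `n` variables of weights at least `v`, with top form `T` of degree `d ≤ v * D`,
`(q - 1) * #(zeros of P) + #(zeros of T) ≤ q ^ (n - 1) * (1 + (q - 1) * D)`.
This is `card_affineZeros_le`, proved by induction on `n`:

* If `D = 0`, both `P` and `T` are nonzero constants. If `T = 0`, or if `T` does not vanish
  identically on the coordinate subspace `W` where the variables of weight exactly `v` are zero, the
  Schwartz–Zippel bound gives at most `(D - 1) * q ^ (n - 1)` zeros of `P`, and the trivial bound
  for `T` suffices (`card_affineZeros_le_of_restriction_ne_zero`).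
* Otherwise the zero set of `T` contains `W`, and averaging over the linear forms in the variables
  of weight `v` yields one, which can be taken to be a variable `x₀`, such that `T` has at most `q`
  times as many zeros as its restriction to `x₀ = 0` (`exists_linearForm_card_le`,
  `exists_linear_change`). That restriction is the top form of every slice of `P` by `x₀ = b`. If
  all the slices are nonzero, the induction hypotheses for the `q` slices add up to the claim.
* If `c ≥ 1` of the slices vanish, `P` is divisible by `c` linear factors `x₀ - b`, so the other
  slices of `P`, and those of `T` for `x₀ ≠ 0`, have degree at most `D - c`, and counting them by
  Schwartz–Zippel is enough (`card_affineZeros_le_of_slice_eq_zero`).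
-/

namespace WeightedProj

/-! ### Polynomials of bounded weighted degree and their top forms -/

/-- `IsTopForm u d P T` says that `P` has weighted degree at most `d` for the weights `u` and that
`T`, which may be zero, is its component of weighted degree exactly `d`. -/
structure IsTopForm {R σ : Type*} [CommRing R] (u : σ → ℕ) (d : ℕ) (P T : MvPolynomial σ R) :
    Prop where
  isWeightedHomogeneous : IsWeightedHomogeneous u T d
  weight_lt : ∀ e ∈ (P - T).support, Finsupp.weight u e < d

namespace IsTopForm

variable {R σ τ : Type*} [CommRing R] {u : σ → ℕ} {d d' : ℕ} {P T P' T' : MvPolynomial σ R}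

theorem refl_of (h : IsWeightedHomogeneous u T d) : IsTopForm u d T T :=
  ⟨h, by simp⟩

theorem add (h : IsTopForm u d P T) (h' : IsTopForm u d P' T') :
    IsTopForm u d (P + P') (T + T') := by
  classical
  refine ⟨h.1.add h'.1, fun e he => ?_⟩
  rw [add_sub_add_comm] at he
  rcases Finset.mem_union.1 (support_add he) with he | he
  exacts [h.2 e he, h'.2 e he]

theorem sum {ι : Type*} (s : Finset ι) (A B : ι → MvPolynomial σ R)
    (h : ∀ i ∈ s, IsTopForm u d (A i) (B i)) :
    IsTopForm u d (∑ i ∈ s, A i) (∑ i ∈ s, B i) := by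
  classical
  induction s using Finset.induction_on with
  | empty => simpa using refl_of (isWeightedHomogeneous_zero R u d)
  | insert a s ha ih =>
    rw [Finset.sum_insert ha, Finset.sum_insert ha]
    exact (h a (Finset.mem_insert_self _ _)).add
      (ih fun i hi => h i (Finset.mem_insert_of_mem hi))

theorem weight_le (h : IsTopForm u d P T) {e : σ →₀ ℕ} (he : e ∈ P.support) :
    Finsupp.weight u e ≤ d := by
  classical
  have : e ∈ (T + (P - T)).support := by rwa [add_sub_cancel]
  rcases Finset.mem_union.1 (support_add this) with he | he
  exacts [(h.1 (mem_support_iff.1 he)).le, (h.2 e he).le]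

theorem mul (h : IsTopForm u d P T) (h' : IsTopForm u d' P' T') :
    IsTopForm u (d + d') (P * P') (T * T') := by
  classical
  refine ⟨h.1.mul h'.1, fun e he => ?_⟩
  rw [show P * P' - T * T' = (P - T) * P' + T * (P' - T') by ring] at he
  rcases Finset.mem_union.1 (support_add he) with he | he <;>
    obtain ⟨a, ha, b, hb, rfl⟩ := Finset.mem_add.1 (support_mul _ _ he) <;> rw [map_add]
  · exact add_lt_add_of_lt_of_le (h.2 a ha) (h'.weight_le hb)
  · exact add_lt_add_of_le_of_lt (h.1 (mem_support_iff.1 ha)).le (h'.2 b hb)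

theorem pow (h : IsTopForm u d P T) (k : ℕ) : IsTopForm u (k * d) (P ^ k) (T ^ k) := by
  induction k with
  | zero => simpa using refl_of (isWeightedHomogeneous_one R u)
  | succ k ih => simpa only [pow_succ, Nat.succ_mul] using ih.mul h

theorem prod {ι : Type*} (s : Finset ι) (A B : ι → MvPolynomial σ R) (k : ι → ℕ)
    (h : ∀ i ∈ s, IsTopForm u (k i) (A i) (B i)) :
    IsTopForm u (∑ i ∈ s, k i) (∏ i ∈ s, A i) (∏ i ∈ s, B i) := by
  classical
  induction s using Finset.induction_on with
  | empty => simpa using refl_of (isWeightedHomogeneous_one R u)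
  | insert a s ha ih =>
    rw [Finset.prod_insert ha, Finset.prod_insert ha, Finset.sum_insert ha]
    exact (h a (Finset.mem_insert_self _ _)).mul
      (ih fun i hi => h i (Finset.mem_insert_of_mem hi))

theorem of_weight_lt (h : ∀ e ∈ P.support, Finsupp.weight u e < d) : IsTopForm u d P 0 :=
  ⟨isWeightedHomogeneous_zero R u d, by simpa using h⟩

/-- A constant, regarded as having positive degree, has zero top form. -/
theorem C_zero (hd : 0 < d) (c : R) : IsTopForm u d (C c : MvPolynomial σ R) 0 :=
  of_weight_lt fun e he => by
    classical
    rw [mem_support_iff, coeff_C] at he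
    obtain rfl : 0 = e := by_contra fun h => he (if_neg h)
    simpa using hd

/-- Substituting for each variable a polynomial whose weighted degree is at most the weight of that
variable does not raise the weighted degree, and the top form of the result comes from substituting
the top forms into the top form. -/
theorem bind₁ {u' : τ → ℕ} {g g₀ : σ → MvPolynomial τ R}
    (hg : ∀ i, IsTopForm u' (u i) (g i) (g₀ i)) (h : IsTopForm u d P T) :
    IsTopForm u' d (MvPolynomial.bind₁ g P) (MvPolynomial.bind₁ g₀ T) := by
  have key : ∀ (e : σ →₀ ℕ) (c : R), IsTopForm u' (Finsupp.weight u e)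
      (MvPolynomial.bind₁ g (monomial e c)) (MvPolynomial.bind₁ g₀ (monomial e c)) := by
    intro e c
    rw [bind₁_monomial, bind₁_monomial]
    have h1 := prod e.support (fun i => g i ^ e i) (fun i => g₀ i ^ e i) (fun i => e i * u i)
      fun i _ => (hg i).pow (e i)
    have h2 := (refl_of (isWeightedHomogeneous_C u' c)).mul h1
    rw [zero_add] at h2
    exact h2
  have hT : IsTopForm u' d (MvPolynomial.bind₁ g T) (MvPolynomial.bind₁ g₀ T) := by
    conv => arg 3; rw [T.as_sum, map_sum]
    conv => arg 4; rw [T.as_sum, map_sum]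
    exact sum _ _ _ fun e he => h.1 (mem_support_iff.1 he) ▸ key e _
  have hL : IsTopForm u' d (MvPolynomial.bind₁ g (P - T)) 0 := by
    conv => arg 3; rw [(P - T).as_sum, map_sum]
    have := sum (u := u') (d := d) (P - T).support
      (fun e => MvPolynomial.bind₁ g (monomial e (coeff e (P - T)))) (fun _ => 0) fun e he =>
      of_weight_lt fun e' he' => ((key e _).weight_le he').trans_lt (h.2 e he)
    simpa only [Finset.sum_const_zero] using this
  simpa only [← map_add, add_sub_cancel, add_zero] using hT.add hL

theorem coeff_eq (h : IsTopForm u d P T) {e : σ →₀ ℕ} (he : Finsupp.weight u e = d) :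
    coeff e P = coeff e T := by
  by_contra hne
  exact (h.2 e (by rwa [mem_support_iff, coeff_sub, sub_ne_zero])).ne he

theorem ne_zero (h : IsTopForm u d P T) (hT : T ≠ 0) : P ≠ 0 := by
  obtain ⟨e, he⟩ := ne_zero_iff.1 hT
  rintro rfl
  exact he (by rw [← h.coeff_eq (h.1 he), coeff_zero])

end IsTopForm

theorem mul_degree_le_weight {σ : Type*} {u : σ → ℕ} {v : ℕ} (hv : ∀ i, v ≤ u i) (e : σ →₀ ℕ) :
    v * e.degree ≤ Finsupp.weight u e := by
  rw [Finsupp.weight_apply, Finsupp.degree_apply, Finsupp.sum, Finset.mul_sum]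
  exact Finset.sum_le_sum fun i _ => by
    rw [mul_comm, smul_eq_mul]; exact Nat.mul_le_mul_left _ (hv i)

/-- If `P` has weighted degree at most `d` and every weight is at least `v`, then its ordinary
degree is at most `k` as soon as `d < v * (k + 1)`. -/
theorem totalDegree_le_of_weight_le {R σ : Type*} [CommRing R] {u : σ → ℕ} {v d k : ℕ}
    (hv : ∀ i, v ≤ u i) (hd : d < v * (k + 1)) {P : MvPolynomial σ R}
    (hP : ∀ e ∈ P.support, Finsupp.weight u e ≤ d) : P.totalDegree ≤ k := by
  refine Finset.sup_le fun e he => ?_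
  have h := (mul_degree_le_weight hv e).trans (hP e he)
  exact Nat.lt_succ_iff.1 (lt_of_mul_lt_mul_left (h.trans_lt hd) (Nat.zero_le v))

/-! ### Counting zeros -/

open Classical in
/-- The zeros of `P` in the affine space of dimension `n` over the finite field `F`. -/
noncomputable def affineZeros {F : Type*} [Field F] [Fintype F] {n : ℕ}
    (P : MvPolynomial (Fin n) F) : Finset (Fin n → F) :=
  {x | eval x P = 0}

/-- The substitution of `b` for the variable of index `0`. -/
noncomputable def slice {F : Type*} [Field F] {n : ℕ} (b : F) (P : MvPolynomial (Fin (n + 1)) F) :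
    MvPolynomial (Fin n) F :=
  bind₁ (Fin.cons (C b) X : Fin (n + 1) → MvPolynomial (Fin n) F) P

theorem eval_slice {F : Type*} [Field F] {n : ℕ} (b : F) (P : MvPolynomial (Fin (n + 1)) F)
    (x : Fin n → F) :
    eval x (slice b P) = eval (Fin.cons b x : Fin (n + 1) → F) P := by
  rw [slice, eval, eval₂Hom_bind₁]
  congr 2
  ext i
  refine Fin.cases ?_ (fun j => ?_) i <;> simp

section Counting

variable {F : Type*} [Field F] [Fintype F] {n : ℕ}

@[simp]
theorem mem_affineZeros {P : MvPolynomial (Fin n) F} {x : Fin n → F} :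
    x ∈ affineZeros P ↔ eval x P = 0 := by
  simp [affineZeros]

theorem card_affineZeros_le_pow (P : MvPolynomial (Fin n) F) :
    (affineZeros P).card ≤ Fintype.card F ^ n :=
  (Finset.card_le_univ _).trans (by simp)

/-- The Schwartz–Zippel bound, without denominators (so that it also makes sense for `n = 0`). -/
theorem card_mul_card_affineZeros_le {P : MvPolynomial (Fin n) F} (hP : P ≠ 0) {k : ℕ}
    (hk : P.totalDegree ≤ k) :
    Fintype.card F * (affineZeros P).card ≤ k * Fintype.card F ^ n := by
  classical
  have h := schwartz_zippel_totalDegree hP (Finset.univ : Finset F)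
  have hq : (0 : ℚ≥0) < Fintype.card F := by exact_mod_cast Fintype.card_pos
  rw [Finset.card_univ, div_le_div_iff₀ (pow_pos hq n) hq, Fintype.piFinset_univ] at h
  have h' : (affineZeros P).card * Fintype.card F ≤ P.totalDegree * Fintype.card F ^ n := by
    rw [show affineZeros P = Finset.univ.filter fun f => eval f P = 0 by ext; simp]
    exact_mod_cast h
  rw [mul_comm]
  exact h'.trans (Nat.mul_le_mul_right _ hk)

theorem card_affineZeros_eq_sum_slice (P : MvPolynomial (Fin (n + 1)) F) :
    (affineZeros P).card = ∑ b, (affineZeros (slice b P)).card := by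
  classical
  rw [← Finset.card_sigma]
  refine Finset.card_bij' (fun x _ => ⟨x 0, Fin.tail x⟩) (fun y _ => Fin.cons y.1 y.2) ?_ ?_ ?_ ?_
  · intro x hx
    simpa [eval_slice] using hx
  · rintro ⟨b, y⟩ hy
    simpa [eval_slice] using hy
  · intro x _
    simp
  · rintro ⟨b, y⟩ _
    simp

end Counting

theorem IsTopForm.slice {F : Type*} [Field F] {n d : ℕ} {u : Fin (n + 1) → ℕ} (hu : 0 < u 0)
    {P T : MvPolynomial (Fin (n + 1)) F} (h : IsTopForm u d P T) (b : F) :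
    IsTopForm (fun i => u i.succ) d (slice b P) (slice 0 T) := by
  refine h.bind₁ fun i => ?_
  refine Fin.cases ?_ (fun j => ?_) i
  · simpa using C_zero hu b
  · simpa using refl_of (isWeightedHomogeneous_X F (fun i : Fin n => u i.succ) j)

/-! ### Slices by the hyperplanes on which the first coordinate is constant -/

section Slices

variable {F : Type*} [Field F] {n : ℕ}

/-- The polynomial in the variable of index `0` which is the coefficient in `P` of the monomial `e`
in the remaining variables. -/
noncomputable def innerCoeff (P : MvPolynomial (Fin (n + 1)) F) (e : Fin n →₀ ℕ) : Polynomial F :=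
  ∑ k ∈ Finset.range ((finSuccEquiv F n P).natDegree + 1),
    Polynomial.monomial k (coeff (e.cons k) P)

theorem coeff_innerCoeff (P : MvPolynomial (Fin (n + 1)) F) (e : Fin n →₀ ℕ) (k : ℕ) :
    (innerCoeff P e).coeff k = coeff (e.cons k) P := by
  rw [innerCoeff, Polynomial.finsetSum_coeff]
  simp only [Polynomial.coeff_monomial, Finset.sum_ite_eq', Finset.mem_range, ite_eq_left_iff,
    not_lt]
  intro hk
  rw [← finSuccEquiv_coeff_coeff, Polynomial.coeff_eq_zero_of_natDegree_lt (by omega), coeff_zero]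

theorem coeff_slice (b : F) (P : MvPolynomial (Fin (n + 1)) F) (e : Fin n →₀ ℕ) :
    coeff e (slice b P) = (innerCoeff P e).eval b := by
  have h : slice b P = (finSuccEquiv F n P).eval (C b) := by
    induction P using MvPolynomial.induction_on with
    | C a => simp [slice, finSuccEquiv_apply]
    | add p q hp hq => simpa [slice, Polynomial.eval_add] using congrArg₂ (· + ·) hp hq
    | mul_X p i hp =>
      rw [map_mul, Polynomial.eval_mul, ← hp, slice, map_mul, bind₁_X_right, slice]
      refine Fin.cases ?_ (fun j => ?_) i <;> simp [finSuccEquiv_X_zero, finSuccEquiv_X_succ]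
  rw [h, Polynomial.eval_eq_sum_range, coeff_sum, innerCoeff, Polynomial.eval_finsetSum]
  refine Finset.sum_congr rfl fun k _ => ?_
  rw [← C_pow, mul_comm, coeff_C_mul, finSuccEquiv_coeff_coeff, Polynomial.eval_monomial, mul_comm]

theorem weight_cons (u : Fin (n + 1) → ℕ) (e : Fin n →₀ ℕ) (k : ℕ) :
    Finsupp.weight u (e.cons k) = k * u 0 + Finsupp.weight (fun i => u i.succ) e := by
  rw [Finsupp.weight_apply, Finsupp.weight_apply, Finsupp.sum_fintype _ _ (by simp),
    Finsupp.sum_fintype _ _ (by simp), Fin.sum_univ_succ]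
  simp

/-- A nonzero weighted homogeneous polynomial stays nonzero when a nonzero value is given to a
variable of positive weight, since the weight determines the exponent of that variable. -/
theorem slice_ne_zero {u : Fin (n + 1) → ℕ} (hu : 0 < u 0) {d : ℕ}
    {T : MvPolynomial (Fin (n + 1)) F} (hT : IsWeightedHomogeneous u T d) (hT0 : T ≠ 0) {a : F}
    (ha : a ≠ 0) : slice a T ≠ 0 := by
  obtain ⟨e, he⟩ := ne_zero_iff.1 hT0
  refine ne_zero_iff.2 ⟨e.tail, ?_⟩
  have hw := hT he
  rw [← Finsupp.cons_tail e, weight_cons] at hw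
  have hmono : innerCoeff T e.tail = Polynomial.monomial (e 0) (coeff e T) := by
    ext k
    rw [coeff_innerCoeff, Polynomial.coeff_monomial]
    split_ifs with hk
    · rw [← hk, Finsupp.cons_tail]
    · by_contra hne
      have hw' := hT hne
      rw [weight_cons] at hw'
      exact hk (Nat.eq_of_mul_eq_mul_right hu (by omega))
  rw [coeff_slice, hmono, Polynomial.eval_monomial]
  exact mul_ne_zero he (pow_ne_zero _ ha)

/-- If all the slices of `P` at the values in `s` vanish, then `P` is divisible by `#s` distinct
linear polynomials in the variable of index `0`; this lowers the degree of `P` in the remaining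
variables. -/
theorem card_add_degree_le {u : Fin (n + 1) → ℕ} {v d D : ℕ} (hv : 0 < v) (hu : ∀ i, v ≤ u i)
    (hd : d ≤ v * D) {P : MvPolynomial (Fin (n + 1)) F}
    (hP : ∀ e ∈ P.support, Finsupp.weight u e ≤ d) (s : Finset F) (hs : ∀ b ∈ s, slice b P = 0)
    (e : Fin n →₀ ℕ) (he : innerCoeff P e ≠ 0) : s.card + e.degree ≤ D := by
  classical
  have h1 : s.card ≤ (innerCoeff P e).natDegree := by
    refine (Finset.card_le_card fun b hb => ?_).trans
      ((Multiset.toFinset_card_le (innerCoeff P e).roots).trans (Polynomial.card_roots' _))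
    rw [Multiset.mem_toFinset, Polynomial.mem_roots he, Polynomial.IsRoot, ← coeff_slice, hs b hb,
      coeff_zero]
  have h2 := hP (e.cons (innerCoeff P e).natDegree) (by
    rw [mem_support_iff, ← coeff_innerCoeff, Polynomial.coeff_natDegree]
    exact Polynomial.leadingCoeff_ne_zero.2 he)
  rw [weight_cons] at h2
  have h3 := mul_degree_le_weight (u := fun i => u i.succ) (fun i => hu i.succ) e
  have h4 : (innerCoeff P e).natDegree * v ≤ (innerCoeff P e).natDegree * u 0 :=
    Nat.mul_le_mul_left _ (hu 0)
  refine le_of_mul_le_mul_left (?_ : v * _ ≤ v * D) hv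
  nlinarith

variable [Fintype F]

/-- The zero bound when some slice `x₀ = b` of `P` vanishes identically: with `c` such slices, the
other ones have degree at most `D - c`. -/
theorem card_affineZeros_le_of_slice_eq_zero {u : Fin (n + 1) → ℕ} {v d D : ℕ} (hv : 0 < v)
    (hu : ∀ i, v ≤ u i) (hd : d ≤ v * D) {P T : MvPolynomial (Fin (n + 1)) F}
    (h : IsTopForm u d P T) (hT : T ≠ 0) {b₀ : F} (hb₀ : slice b₀ P = 0) :
    Fintype.card F * ((Fintype.card F - 1) * (affineZeros P).card + (affineZeros T).card) ≤
      Fintype.card F ^ (n + 1) * (1 + (Fintype.card F - 1) * D) := by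
  classical
  obtain ⟨r, hr⟩ : ∃ r, Fintype.card F = r + 1 :=
    ⟨_, (Nat.succ_pred_eq_of_pos Fintype.card_pos).symm⟩
  have hu0 : 0 < u 0 := hv.trans_le (hu 0)
  set s : Finset F := {b | slice b P = 0} with hs
  set c := s.card with hc
  have hmem : ∀ b, b ∈ s ↔ slice b P = 0 := by simp [hs]
  have hc1 : 1 ≤ c := Finset.card_pos.2 ⟨b₀, (hmem b₀).2 hb₀⟩
  have hcr : c ≤ r + 1 := hr ▸ Finset.card_le_univ s
  have hdeg := card_add_degree_le hv hu hd (fun e => h.weight_le) s fun b hb => (hmem b).1 hb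
  obtain ⟨e₀, he₀⟩ := ne_zero_iff.1 (slice_ne_zero hu0 h.1 hT one_ne_zero)
  have hinner : ∀ e, innerCoeff T e ≠ 0 → innerCoeff P e ≠ 0 := by
    intro e he hP
    refine he (Polynomial.ext fun k => ?_)
    by_contra hk
    rw [coeff_innerCoeff, Polynomial.coeff_zero] at hk
    rw [← h.coeff_eq (h.1 hk), ← coeff_innerCoeff, hP] at hk
    exact hk (Polynomial.coeff_zero k)
  obtain ⟨k, hk⟩ : ∃ k, D = c + k := by
    refine Nat.exists_eq_add_of_le
      ((Nat.le_add_right _ _).trans (hdeg e₀ (hinner e₀ fun h0 => he₀ ?_)))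
    rw [coeff_slice, h0, Polynomial.eval_zero]
  have hP : ∀ b ∉ s, Fintype.card F * (affineZeros (slice b P)).card ≤ k * Fintype.card F ^ n := by
    intro b hb
    refine card_mul_card_affineZeros_le (fun h0 => hb ((hmem b).2 h0))
      (Finset.sup_le fun e he => ?_)
    have := hdeg e fun h0 => mem_support_iff.1 he (by rw [coeff_slice, h0, Polynomial.eval_zero])
    change e.degree ≤ k
    omega
  have hTb : ∀ b ≠ 0, Fintype.card F * (affineZeros (slice b T)).card ≤ k * Fintype.card F ^ n := by
    intro b hb
    refine card_mul_card_affineZeros_le (slice_ne_zero hu0 h.1 hT hb) (Finset.sup_le fun e he => ?_)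
    have := hdeg e (hinner e fun h0 =>
      mem_support_iff.1 he (by rw [coeff_slice, h0, Polynomial.eval_zero]))
    change e.degree ≤ k
    omega
  have hPsum : Fintype.card F * (affineZeros P).card ≤
      c * Fintype.card F ^ (n + 1) + (r + 1 - c) * (k * Fintype.card F ^ n) := by
    rw [card_affineZeros_eq_sum_slice, Finset.mul_sum, ← Finset.sum_add_sum_compl s]
    refine add_le_add ?_ ?_
    · rw [hc, ← smul_eq_mul, ← Finset.sum_const]
      refine Finset.sum_le_sum fun b _ => ?_
      rw [pow_succ, mul_comm]
      exact Nat.mul_le_mul_right _ (card_affineZeros_le_pow _)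
    · rw [← hr, hc, ← Finset.card_compl, ← smul_eq_mul, ← Finset.sum_const]
      exact Finset.sum_le_sum fun b hb => hP b (Finset.mem_compl.1 hb)
  have hTsum : Fintype.card F * (affineZeros T).card ≤
      Fintype.card F ^ (n + 1) + r * (k * Fintype.card F ^ n) := by
    rw [card_affineZeros_eq_sum_slice, Finset.mul_sum, ← Finset.sum_add_sum_compl {0},
      Finset.sum_singleton]
    refine add_le_add ?_ ?_
    · rw [pow_succ, mul_comm]
      exact Nat.mul_le_mul_right _ (card_affineZeros_le_pow _)
    · have : r = ({0}ᶜ : Finset F).card := by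
        rw [Finset.card_compl, Finset.card_singleton, hr, Nat.add_sub_cancel]
      rw [this, ← smul_eq_mul, ← Finset.sum_const]
      exact Finset.sum_le_sum fun b hb => hTb b (by simpa using hb)
  rw [hr] at hPsum hTsum ⊢
  obtain ⟨t, ht⟩ : ∃ t, r + 1 = c + t := Nat.exists_eq_add_of_le hcr
  rw [show r + 1 - c = t by omega] at hPsum
  rw [Nat.add_sub_cancel, hk]
  -- The inequality to check is `c * q + (t + 1) * k ≤ q * (c + k)`, where `t + 1 ≤ q` as `1 ≤ c`.
  have h1 : (t + 1) * k ≤ (r + 1) * k := Nat.mul_le_mul_right _ (by omega)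
  calc (r + 1) * (r * (affineZeros P).card + (affineZeros T).card)
      = r * ((r + 1) * (affineZeros P).card) + (r + 1) * (affineZeros T).card := by ring
    _ ≤ r * (c * (r + 1) ^ (n + 1) + t * (k * (r + 1) ^ n)) +
          ((r + 1) ^ (n + 1) + r * (k * (r + 1) ^ n)) := by gcongr
    _ = (r + 1) ^ n * (r * (c * (r + 1) + (t + 1) * k) + (r + 1)) := by ring
    _ ≤ (r + 1) ^ n * (r * (c * (r + 1) + (r + 1) * k) + (r + 1)) := by gcongr
    _ = (r + 1) ^ (n + 1) * (1 + r * (c + k)) := by ring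

end Slices

/-! ### Reduction to slices by a linear form -/

section LinearForms

variable {F : Type*} [Field F] [Fintype F] {n : ℕ}

theorem pow_le_mul_card_ker [DecidableEq F] (L : (Fin n → F) →ₗ[F] F) :
    Fintype.card F ^ n ≤ Fintype.card F * (Finset.univ.filter fun a => L a = 0).card := by
  have h := Finset.card_eq_sum_card_fiberwise (s := (Finset.univ : Finset (Fin n → F)))
    (t := Finset.univ) (f := L) (fun _ _ => Finset.mem_coe.2 (Finset.mem_univ _))
  rw [Finset.card_univ, Fintype.card_fun, Fintype.card_fin] at h
  rw [h, ← Finset.card_univ, ← smul_eq_mul, ← Finset.sum_const]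
  refine Finset.sum_le_sum fun b _ => ?_
  obtain h0 | ⟨a₀, ha₀⟩ := (Finset.univ.filter fun a => L a = b).eq_empty_or_nonempty
  · simp [h0]
  · refine Finset.card_le_card_of_injOn (fun a => a - a₀) (fun a ha => ?_)
      (sub_left_injective.injOn)
    simp only [Finset.mem_filter, Finset.mem_univ, true_and, Finset.coe_filter,
      Set.mem_ofPred_eq] at ha ha₀ ⊢
    rw [map_sub, ha, ha₀, sub_self]

/-- A set containing the subspace `x i = 0` (`i ∈ S`) has at least the expected proportion `1 / q`
of its points on the kernel of some nonzero linear form in the coordinates of `S`. This comes from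
averaging over all linear forms. -/
theorem exists_linearForm_card_le [DecidableEq F] (S : Finset (Fin n)) (hS : S.Nonempty)
    (Z : Finset (Fin n → F)) (hZ : ∀ x : Fin n → F, (∀ i ∈ S, x i = 0) → x ∈ Z) :
    ∃ a : Fin n → F, a ≠ 0 ∧ (∀ i ∉ S, a i = 0) ∧
      Z.card ≤ Fintype.card F * (Z.filter fun x => ∑ i, a i * x i = 0).card := by
  set W : Finset (Fin n → F) := {x | ∀ i ∈ S, x i = 0} with hW
  have hmemW : ∀ x, x ∈ W ↔ ∀ i ∈ S, x i = 0 := by simp [hW]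
  have hWZ : W ⊆ Z := fun x hx => hZ x ((hmemW x).1 hx)
  set K : (Fin n → F) → ℕ := fun a => (Z.filter fun x => ∑ i ∈ S, a i * x i = 0).card with hK
  set q := Fintype.card F with hq
  by_contra! hcon
  have hlt : ∀ a ∉ W, q * K a < Z.card := by
    intro a ha
    have hsum : ∀ x : Fin n → F,
        ∑ i, (if i ∈ S then a i else 0) * x i = ∑ i ∈ S, a i * x i := fun x => by
      simp [ite_mul, Finset.sum_ite_mem]
    have := hcon (fun i => if i ∈ S then a i else 0) (fun h0 => ha ((hmemW a).2 fun i hi => by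
      simpa [hi] using congrFun h0 i)) fun i hi => if_neg hi
    simpa only [hsum] using this
  have hupper : ∑ a, q * K a + Wᶜ.card ≤ W.card * (q * Z.card) + Wᶜ.card * Z.card := by
    rw [← Finset.sum_add_sum_compl W, add_assoc]
    refine add_le_add ?_ ?_
    · rw [← smul_eq_mul, ← Finset.sum_const]
      exact Finset.sum_le_sum fun a _ =>
        Nat.mul_le_mul_left _ (Finset.card_le_card (Finset.filter_subset _ _))
    · rw [Finset.card_eq_sum_ones, ← Finset.sum_add_distrib, ← Finset.card_eq_sum_ones,
        ← smul_eq_mul, ← Finset.sum_const]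
      exact Finset.sum_le_sum fun a ha => hlt a (Finset.mem_compl.1 ha)
  have hswap : ∑ a, K a =
      ∑ x ∈ Z, (Finset.univ.filter fun a : Fin n → F => ∑ i ∈ S, a i * x i = 0).card := by
    simp only [hK, Finset.card_filter]
    exact Finset.sum_comm
  have hlower : (Z \ W).card * q ^ n + W.card * (q * q ^ n) ≤ ∑ a, q * K a := by
    rw [← Finset.mul_sum, hswap, Finset.mul_sum, ← Finset.sum_sdiff hWZ]
    refine add_le_add ?_ ?_
    · rw [← smul_eq_mul, ← Finset.sum_const]
      refine Finset.sum_le_sum fun x _ => ?_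
      have := pow_le_mul_card_ker (∑ i ∈ S, x i • LinearMap.proj (R := F) (φ := fun _ => F) i)
      simpa [mul_comm] using this
    · rw [← smul_eq_mul, ← Finset.sum_const]
      refine Finset.sum_le_sum fun x hx => Nat.mul_le_mul_left _ ?_
      rw [Finset.filter_true_of_mem, Finset.card_univ, Fintype.card_fun, Fintype.card_fin]
      exact fun a _ => Finset.sum_eq_zero fun i hi => by rw [(hmemW x).1 hx i hi, mul_zero]
  have hcompl : Wᶜ.card + W.card = q ^ n := by
    rw [Finset.card_compl_add_card, Fintype.card_fun, Fintype.card_fin]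
  have hsdiff : (Z \ W).card + W.card = Z.card := Finset.card_sdiff_add_card_eq_card hWZ
  have hpos : 0 < Wᶜ.card := by
    obtain ⟨i, hi⟩ := hS
    exact Finset.card_pos.2 ⟨fun _ => 1, Finset.mem_compl.2 fun h =>
      one_ne_zero ((hmemW _).1 h i hi)⟩
  have hZle : Z.card ≤ q ^ n := (Finset.card_le_univ Z).trans (by simp [hq])
  obtain ⟨r, hr⟩ : ∃ r, q = r + 1 := ⟨_, (Nat.succ_pred_eq_of_pos Fintype.card_pos).symm⟩
  have hfin : r * W.card * Z.card ≤ r * W.card * q ^ n := Nat.mul_le_mul_left _ hZle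
  have hall := (add_le_add_left hlower Wᶜ.card).trans hupper
  rw [← hcompl] at hall hfin
  rw [← hsdiff] at hall hfin
  rw [hr] at hall
  nlinarith

/-- If the top form does not vanish identically where all the variables of the least weight `v`
are zero, then, for any values of these variables, `P` is a nonzero polynomial of degree at most `k`
in the variables of higher weight. -/
theorem card_affineZeros_le_of_restriction_ne_zero {u : Fin n → ℕ} {v d k : ℕ} (hv : 0 < v)
    (hu : ∀ i, v ≤ u i) (hd : d ≤ v * (k + 1)) {P T : MvPolynomial (Fin n) F}
    (h : IsTopForm u d P T) (hT : bind₁ (fun i => if u i = v then 0 else X i) T ≠ 0) :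
    Fintype.card F * (affineZeros P).card ≤ k * Fintype.card F ^ n := by
  classical
  set g : (Fin n → F) → Fin n → MvPolynomial (Fin n) F :=
    fun z i => if u i = v then C (z i) else X i with hg
  set u' : Fin n → ℕ := fun i => if u i = v then v + 1 else u i with hu'
  have htop : ∀ z, IsTopForm u' d (bind₁ (g z) P)
      (bind₁ (fun i => if u i = v then 0 else X i) T) := by
    refine fun z => h.bind₁ fun i => ?_
    by_cases hi : u i = v
    · simpa only [hg, if_pos hi] using IsTopForm.C_zero (hi ▸ hv) (z i)
    · simp only [hg, if_neg hi]
      have := isWeightedHomogeneous_X F u' i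
      simp only [hu', if_neg hi] at this
      exact IsTopForm.refl_of this
  have hle : ∀ z, Fintype.card F * (affineZeros (bind₁ (g z) P)).card ≤
      k * Fintype.card F ^ n := by
    refine fun z => card_mul_card_affineZeros_le ((htop z).ne_zero hT)
      (totalDegree_le_of_weight_le (v := v + 1) (fun i => ?_) ?_ fun e => (htop z).weight_le)
    · have := hu i
      simp only [hu']
      split_ifs <;> omega
    · nlinarith
  have heval : ∀ z x, eval x (bind₁ (g z) P) = eval (fun i => if u i = v then z i else x i) P := by
    intro z x
    rw [eval, eval₂Hom_bind₁]
    congr 2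
    ext i
    simp only [hg]
    split_ifs <;> simp
  -- Exchanging the coordinates of weight `v` between `x` and `z` identifies the pairs of an
  -- arbitrary vector and a zero of `P` with the pairs of a vector and a zero of the restriction of
  -- `P` that it defines.
  have hcount : Fintype.card F ^ n * (affineZeros P).card ≤
      ∑ z, (affineZeros (bind₁ (g z) P)).card := by
    rw [← Finset.card_sigma]
    have : Fintype.card F ^ n * (affineZeros P).card =
        ((Finset.univ : Finset (Fin n → F)) ×ˢ affineZeros P).card := by
      rw [Finset.card_product]; simp
    rw [this]
    refine Finset.card_le_card_of_injOn (fun y => ⟨fun i => if u i = v then y.2 i else y.1 i,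
      fun i => if u i = v then y.1 i else y.2 i⟩) ?_ ?_
    · rintro ⟨t, y⟩ hy
      have hy' : eval y P = 0 := by simpa using hy
      simp only [Finset.coe_sigma, Set.mem_sigma_iff, Finset.mem_coe, Finset.mem_univ, true_and,
        mem_affineZeros, heval]
      rw [← hy']
      congr 2
      ext i
      split_ifs <;> rfl
    · rintro ⟨t, y⟩ _ ⟨t', y'⟩ _ hyy
      simp only [Sigma.mk.injEq, heq_eq_eq, _root_.funext_iff] at hyy
      refine Prod.ext (funext fun i => ?_) (funext fun i => ?_) <;>
        have h1 := hyy.1 i <;> have h2 := hyy.2 i <;> by_cases hi : u i = v <;> simp_all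
  have hq : 0 < Fintype.card F ^ n := pow_pos Fintype.card_pos n
  refine le_of_mul_le_mul_left ?_ hq
  calc Fintype.card F ^ n * (Fintype.card F * (affineZeros P).card)
      = Fintype.card F * (Fintype.card F ^ n * (affineZeros P).card) := by ring
    _ ≤ Fintype.card F * ∑ z, (affineZeros (bind₁ (g z) P)).card := Nat.mul_le_mul_left _ hcount
    _ ≤ ∑ _z : Fin n → F, k * Fintype.card F ^ n := by
      rw [Finset.mul_sum]; exact Finset.sum_le_sum fun z _ => hle z
    _ = Fintype.card F ^ n * (k * Fintype.card F ^ n) := by simp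

/-- A linear form in variables of weight `v` can be taken as the variable of index `0`. -/
theorem exists_linear_change [DecidableEq F] {u : Fin (n + 1) → ℕ} {v d : ℕ} (hu : ∀ i, v ≤ u i)
    {P T : MvPolynomial (Fin (n + 1)) F} (h : IsTopForm u d P T) (hT : T ≠ 0)
    {a : Fin (n + 1) → F} (ha : a ≠ 0) (hav : ∀ i, a i ≠ 0 → u i = v) :
    ∃ (u' : Fin (n + 1) → ℕ) (P' T' : MvPolynomial (Fin (n + 1)) F), u' 0 = v ∧
      (∀ i, v ≤ u' i) ∧ IsTopForm u' d P' T' ∧ T' ≠ 0 ∧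
      (affineZeros P').card = (affineZeros P).card ∧ (affineZeros T').card = (affineZeros T).card ∧
      (affineZeros (slice 0 T')).card =
        ((affineZeros T).filter fun x => ∑ i, a i * x i = 0).card := by
  obtain ⟨j, hj⟩ : ∃ j, a j ≠ 0 := Function.ne_iff.1 ha
  set φ : Fin (n + 1) → MvPolynomial (Fin (n + 1)) F := j.insertNth
    (C (a j)⁻¹ * (X 0 - ∑ i, C (a (j.succAbove i)) * X i.succ)) (fun i => X i.succ) with hφ
  set φ' : Fin (n + 1) → MvPolynomial (Fin (n + 1)) F :=
    Fin.cons (∑ i, C (a i) * X i) (fun i => X (j.succAbove i)) with hφ'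
  set ψ : (Fin (n + 1) → F) → Fin (n + 1) → F := fun y => j.insertNth
    ((a j)⁻¹ * (y 0 - ∑ i, a (j.succAbove i) * y i.succ)) (fun i => y i.succ) with hψ
  set u' : Fin (n + 1) → ℕ := Fin.cons v fun i => u (j.succAbove i) with hu'
  have hform : ∀ y, ∑ i, a i * ψ y i = y 0 := by
    intro y
    rw [Fin.sum_univ_succAbove _ j]
    simp only [hψ, Fin.insertNth_apply_same, Fin.insertNth_apply_succAbove]
    rw [mul_inv_cancel_left₀ hj, sub_add_cancel]
  have hψinj : Function.Injective ψ := by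
    intro y z hyz
    ext i
    refine Fin.cases ?_ (fun i => ?_) i
    · rw [← hform y, ← hform z, hyz]
    · simpa [hψ] using congrFun hyz (j.succAbove i)
  have hψbij := Finite.injective_iff_bijective.1 hψinj
  have heval : ∀ (y : Fin (n + 1) → F) (R : MvPolynomial (Fin (n + 1)) F),
      eval y (bind₁ φ R) = eval (ψ y) R := by
    intro y R
    rw [eval, eval₂Hom_bind₁]
    congr 2
    ext i
    refine Fin.succAboveCases j ?_ (fun i => ?_) i
    · simp [hφ, hψ]
    · simp [hφ, hψ]
  have hcard : ∀ R : MvPolynomial (Fin (n + 1)) F,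
      (affineZeros (bind₁ φ R)).card = (affineZeros R).card := by
    intro R
    refine Finset.card_bijective ψ hψbij fun y => ?_
    rw [mem_affineZeros, mem_affineZeros, heval]
  have hhom : ∀ i, IsWeightedHomogeneous u' (φ i) (u i) := by
    intro i
    refine Fin.succAboveCases j ?_ (fun i => ?_) i
    · simp only [hφ, Fin.insertNth_apply_same]
      rw [hav j hj]
      refine IsWeightedHomogeneous.C_mul (IsWeightedHomogeneous.sub ?_ ?_) _
      · simpa [hu'] using isWeightedHomogeneous_X F u' 0
      · refine IsWeightedHomogeneous.sum _ _ _ fun i _ => ?_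
        by_cases hi : a (j.succAbove i) = 0
        · simpa [hi] using isWeightedHomogeneous_zero F u' v
        · refine IsWeightedHomogeneous.C_mul ?_ _
          simpa [hu', hav _ hi] using isWeightedHomogeneous_X F u' i.succ
    · simp only [hφ, Fin.insertNth_apply_succAbove]
      simpa [hu'] using isWeightedHomogeneous_X F u' i.succ
  have hinv : bind₁ φ' (bind₁ φ T) = T := by
    have hX : (fun i => bind₁ φ' (φ i)) = X := by
      ext1 i
      refine Fin.succAboveCases j ?_ (fun i => ?_) i
      · simp only [hφ, hφ', Fin.insertNth_apply_same, map_mul, map_sub, map_sum, bind₁_X_right,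
          Fin.cons_zero, Fin.cons_succ, bind₁_C_right]
        rw [Fin.sum_univ_succAbove _ j, add_sub_cancel_right, ← mul_assoc, ← C_mul,
          inv_mul_cancel₀ hj, C_1, one_mul]
      · simp [hφ, hφ']
    rw [bind₁_bind₁, hX, bind₁_X_left, AlgHom.id_apply]
  refine ⟨u', bind₁ φ P, bind₁ φ T, rfl, Fin.cases le_rfl fun i => hu _,
    h.bind₁ fun i => IsTopForm.refl_of (hhom i), fun h0 => hT (by rw [← hinv, h0, map_zero]),
    hcard P, hcard T, ?_⟩
  refine Finset.card_bij (fun y _ => ψ (Fin.cons 0 y)) ?_ ?_ ?_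
  · intro y hy
    rw [mem_affineZeros, eval_slice, heval] at hy
    rw [Finset.mem_filter, mem_affineZeros, hform]
    exact ⟨hy, rfl⟩
  · intro y _ z _ hyz
    exact Fin.cons_right_injective _ (hψinj hyz)
  · intro x hx
    rw [Finset.mem_filter, mem_affineZeros] at hx
    obtain ⟨y, rfl⟩ := hψbij.2 x
    rw [hform] at hx
    have hy : (Fin.cons 0 (Fin.tail y) : Fin (n + 1) → F) = y := by
      rw [← hx.2, Fin.cons_self_tail]
    refine ⟨Fin.tail y, ?_, by rw [hy]⟩
    rw [mem_affineZeros, eval_slice, heval, hy]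
    exact hx.1

end LinearForms

/-! ### The affine bound -/

section AffineBound

variable {F : Type*} [Field F] [Fintype F]

/-- The key estimate, for a polynomial together with its top form. It is homogeneous in shape: the
homogenization of `P` by a variable of weight `1` has
`(q - 1) * #(affineZeros P) + #(affineZeros T)` zeros. The factor `q` on the left avoids
`q ^ (n - 1)` and keeps the estimate meaningful for `n = 0`. -/
theorem card_affineZeros_le {n : ℕ} {u : Fin n → ℕ} {v d D : ℕ} (hv : 0 < v)
    (hu : ∀ i, v ≤ u i) (hd : d ≤ v * D) {P T : MvPolynomial (Fin n) F} (h : IsTopForm u d P T)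
    (hP : P ≠ 0) :
    Fintype.card F * ((Fintype.card F - 1) * (affineZeros P).card + (affineZeros T).card) ≤
      Fintype.card F ^ n * (1 + (Fintype.card F - 1) * D) := by
  classical
  induction n using Nat.strong_induction_on with
  | _ n ih =>
  obtain ⟨r, hr⟩ : ∃ r, Fintype.card F = r + 1 :=
    ⟨_, (Nat.succ_pred_eq_of_pos Fintype.card_pos).symm⟩
  obtain rfl | ⟨k, rfl⟩ : D = 0 ∨ ∃ k, D = k + 1 := by
    cases D
    exacts [Or.inl rfl, Or.inr ⟨_, rfl⟩]
  · -- In degree `0` both `P` and `T` are the same nonzero constant.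
    obtain rfl : d = 0 := by simpa using hd
    have hPT : P = T := by
      refine sub_eq_zero.1 (support_eq_empty.1 (Finset.eq_empty_of_forall_notMem fun e he => ?_))
      exact absurd (h.weight_lt e he) (Nat.not_lt_zero _)
    have h0 := card_mul_card_affineZeros_le hP
      (totalDegree_le_of_weight_le hu (k := 0) (by omega) fun e => h.weight_le)
    rw [zero_mul, hr] at h0
    have h1 : (affineZeros P).card = 0 := by
      by_contra hne
      exact absurd h0 (Nat.not_le.2 (Nat.mul_pos r.succ_pos (Nat.pos_of_ne_zero hne)))
    rw [← hPT, h1]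
    simp
  -- It is enough that `P` has at most as many zeros as a polynomial of degree `D - 1`, since then
  -- the trivial bound on the zeros of `T` will do.
  have hsuff : Fintype.card F * (affineZeros P).card ≤ k * Fintype.card F ^ n →
      Fintype.card F * ((Fintype.card F - 1) * (affineZeros P).card + (affineZeros T).card) ≤
        Fintype.card F ^ n * (1 + (Fintype.card F - 1) * (k + 1)) := by
    intro hle
    have hT := card_affineZeros_le_pow T
    rw [hr] at hle hT ⊢
    rw [Nat.add_sub_cancel]
    calc (r + 1) * (r * (affineZeros P).card + (affineZeros T).card)
        = r * ((r + 1) * (affineZeros P).card) + (r + 1) * (affineZeros T).card := by ring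
      _ ≤ r * (k * (r + 1) ^ n) + (r + 1) * (r + 1) ^ n := by gcongr
      _ = (r + 1) ^ n * (1 + r * (k + 1)) := by ring
  by_cases hT : T = 0
  · refine hsuff (card_mul_card_affineZeros_le hP
      (totalDegree_le_of_weight_le (d := d - 1) hu ?_ ?_))
    · have : 0 < v * (k + 1) := Nat.mul_pos hv k.succ_pos
      omega
    · intro e he
      exact Nat.le_sub_one_of_lt (h.weight_lt e (by rwa [hT, sub_zero]))
  by_cases hT₀ : bind₁ (fun i => if u i = v then 0 else X i) T = 0
  swap
  · exact hsuff (card_affineZeros_le_of_restriction_ne_zero hv hu hd h hT₀)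
  set S : Finset (Fin n) := {i | u i = v} with hS
  have hmemS : ∀ i, i ∈ S ↔ u i = v := by simp [hS]
  have hSne : S.Nonempty := by
    rw [Finset.nonempty_iff_ne_empty]
    intro hempty
    have hX : (fun i => if u i = v then 0 else X i) = (X : Fin n → MvPolynomial (Fin n) F) := by
      ext1 i
      refine if_neg fun hi => ?_
      rw [← hmemS, hempty] at hi
      simp at hi
    rw [hX, bind₁_X_left] at hT₀
    exact hT hT₀
  have hvanish : ∀ x : Fin n → F, (∀ i ∈ S, x i = 0) → x ∈ affineZeros T := by
    intro x hx
    rw [mem_affineZeros]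
    have hev : eval x (bind₁ (fun i => if u i = v then 0 else X i) T) = eval x T := by
      rw [eval, eval₂Hom_bind₁]
      congr 2
      ext i
      split_ifs with hi
      · simp [hx i ((hmemS i).2 hi)]
      · simp
    rw [← hev, hT₀, map_zero]
  obtain ⟨a, ha, haS, hcard⟩ := exists_linearForm_card_le S hSne (affineZeros T) hvanish
  obtain _ | n := n
  · exact absurd (Subsingleton.elim a 0) ha
  obtain ⟨u', P', T', hu'0, hu', h', hT', hPc, hTc, hsl⟩ := exists_linear_change hu h hT ha
    fun i hi => (hmemS i).1 (by_contra fun hn => hi (haS i hn))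
  rw [← hTc, ← hsl] at hcard
  rw [← hPc, ← hTc]
  by_cases hzero : ∃ b, slice b P' = 0
  · obtain ⟨b, hb⟩ := hzero
    exact card_affineZeros_le_of_slice_eq_zero hv hu' hd h' hT' hb
  push Not at hzero
  have hslice : ∀ b, Fintype.card F * (r * (affineZeros (slice b P')).card +
      (affineZeros (slice 0 T')).card) ≤ Fintype.card F ^ n * (1 + r * (k + 1)) := by
    intro b
    have := ih n (Nat.lt_succ_self n) (fun i => hu' i.succ)
      (h'.slice (hu'0 ▸ hv) b) (hzero b)
    rwa [hr, Nat.add_sub_cancel, ← hr] at this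
  have hsum := Finset.sum_le_sum fun b (_ : b ∈ (Finset.univ : Finset F)) => hslice b
  rw [← Finset.mul_sum, Finset.sum_add_distrib, ← Finset.mul_sum, ← card_affineZeros_eq_sum_slice,
    Finset.sum_const, Finset.sum_const, Finset.card_univ, smul_eq_mul, smul_eq_mul] at hsum
  rw [hr] at hsum hcard ⊢
  rw [Nat.add_sub_cancel]
  calc (r + 1) * (r * (affineZeros P').card + (affineZeros T').card)
      ≤ (r + 1) * (r * (affineZeros P').card + (r + 1) * (affineZeros (slice 0 T')).card) := by
        gcongr
    _ ≤ (r + 1) * ((r + 1) ^ n * (1 + r * (k + 1))) := hsum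
    _ = (r + 1) ^ (n + 1) * (1 + r * (k + 1)) := by ring

/-- The affine form of the bound for a weighted homogeneous polynomial: sum the key estimate over
the values `a ≠ 0` of the variable of index `0`, for which `f (a, ·)` has top form `f (0, ·)`. -/
theorem card_affineZeros_le_of_isWeightedHomogeneous {n : ℕ} {w : Fin (n + 1) → ℕ} {v d D : ℕ}
    (hv : 0 < v) (hw0 : 0 < w 0) (hw : ∀ i : Fin n, v ≤ w i.succ) (hd : d ≤ v * D)
    {f : MvPolynomial (Fin (n + 1)) F} (hf : IsWeightedHomogeneous w f d) (hf0 : f ≠ 0) :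
    Fintype.card F * (affineZeros f).card ≤
      Fintype.card F ^ n * (1 + (Fintype.card F - 1) * D) := by
  classical
  obtain ⟨r, hr⟩ : ∃ r, Fintype.card F = r + 1 :=
    ⟨_, (Nat.succ_pred_eq_of_pos Fintype.card_pos).symm⟩
  have hr0 : 0 < r := by
    have := Fintype.one_lt_card (α := F)
    omega
  have hslice : ∀ b ∈ ({0}ᶜ : Finset F), Fintype.card F * (r * (affineZeros (slice b f)).card +
      (affineZeros (slice 0 f)).card) ≤ Fintype.card F ^ n * (1 + r * D) := by
    intro b hb
    have := card_affineZeros_le hv hw hd ((IsTopForm.refl_of hf).slice hw0 b)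
      (slice_ne_zero hw0 hf hf0 (by simpa using hb))
    rwa [hr, Nat.add_sub_cancel, ← hr] at this
  have hsum := Finset.sum_le_sum hslice
  rw [← Finset.mul_sum, Finset.sum_add_distrib, ← Finset.mul_sum,
    Finset.sum_const, Finset.sum_const, Finset.card_compl, Finset.card_singleton, smul_eq_mul,
    smul_eq_mul] at hsum
  have htotal : (affineZeros f).card = (affineZeros (slice 0 f)).card +
      ∑ b ∈ ({0}ᶜ : Finset F), (affineZeros (slice b f)).card := by
    rw [card_affineZeros_eq_sum_slice, ← Finset.sum_add_sum_compl {0}, Finset.sum_singleton]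
  rw [hr, Nat.add_sub_cancel] at hsum ⊢
  refine le_of_mul_le_mul_left ?_ hr0
  rw [htotal]
  calc r * ((r + 1) * ((affineZeros (slice 0 f)).card +
        ∑ b ∈ ({0}ᶜ : Finset F), (affineZeros (slice b f)).card))
      = (r + 1) * (r * ∑ b ∈ ({0}ᶜ : Finset F), (affineZeros (slice b f)).card +
          r * (affineZeros (slice 0 f)).card) := by ring
    _ ≤ r * ((r + 1) ^ n * (1 + r * D)) := hsum

end AffineBound

/-! ### From rational points to vectors over the finite field -/

section RationalPoints

variable {F : Type*} [Field F] {m : ℕ}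

/-- The nonzero vector over the algebraic closure given by a nonzero vector over `F`. -/
noncomputable def Punctured.ofVec (x : {x : Fin (m + 1) → F // x ≠ 0}) : Punctured F m :=
  ⟨fun i => algebraMap F (AlgebraicClosure F) (x.1 i), fun h => x.2 <| funext fun i =>
    (map_eq_zero _).1 (congrFun h i)⟩

theorem aeval_ofVec (x : {x : Fin (m + 1) → F // x ≠ 0}) (f : MvPolynomial (Fin (m + 1)) F) :
    aeval (Punctured.ofVec x).1 f = algebraMap F (AlgebraicClosure F) (eval x.1 f) := by
  rw [eval, coe_eval₂Hom, hom_eval₂, RingHom.comp_id, aeval_def]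
  rfl

/-- The vectors over `F` representing a given rational point include a copy of `Fˣ`. If `g` is the
greatest common divisor of the weights of the nonzero coordinates, they are
`ξ ^ (w i / g) * x i` for `ξ` in `Fˣ`, given by the geometric scalars `t` with `t ^ g = ξ`. -/
theorem exists_injective_rep {w : Fin (m + 1) → ℕ} (hw : ∀ i, 1 ≤ w i)
    (x : {x : Fin (m + 1) → F // x ≠ 0}) :
    ∃ j : Fˣ → {x : Fin (m + 1) → F // x ≠ 0}, Function.Injective j ∧
      ∀ ξ, Space.mk w (Punctured.ofVec (j ξ)) = Space.mk w (Punctured.ofVec x) := by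
  classical
  obtain ⟨i₀, hi₀⟩ : ∃ i, x.1 i ≠ 0 := Function.ne_iff.1 x.2
  set s : Finset (Fin (m + 1)) := {i | x.1 i ≠ 0} with hs
  have hmem : ∀ i, i ∈ s ↔ x.1 i ≠ 0 := by simp [hs]
  set g := s.gcd w with hg
  have hwi₀ : w i₀ ≠ 0 := Nat.one_le_iff_ne_zero.1 (hw i₀)
  have hg0 : 0 < g := Nat.pos_of_dvd_of_pos (Finset.gcd_dvd ((hmem i₀).2 hi₀)) (hw i₀)
  refine ⟨fun ξ => ⟨fun i => (ξ : F) ^ (w i / g) * x.1 i, fun h => ?_⟩, ?_, ?_⟩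
  · have := congrFun h i₀
    simp [hi₀] at this
  · intro ξ ξ' h
    have hdvd : orderOf (ξ / ξ') ∣ s.gcd fun i => w i / g := by
      refine Finset.dvd_gcd fun i hi => orderOf_dvd_of_pow_eq_one ?_
      have hi' := mul_right_cancel₀ ((hmem i).1 hi) (congrFun (Subtype.ext_iff.1 h) i)
      rw [div_pow, div_eq_one]
      exact Units.ext (by simpa using hi')
    rw [Finset.gcd_div_eq_one ((hmem i₀).2 hi₀) hwi₀, Nat.dvd_one, orderOf_eq_one_iff,
      div_eq_one] at hdvd
    exact hdvd
  · intro ξ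
    obtain ⟨t, ht⟩ := IsAlgClosed.exists_pow_nat_eq (algebraMap F (AlgebraicClosure F) ξ) hg0
    have ht0 : t ≠ 0 := by
      rintro rfl
      rw [zero_pow hg0.ne'] at ht
      exact ξ.ne_zero ((map_eq_zero _).1 ht.symm)
    refine (Quotient.sound ⟨Units.mk0 t ht0, fun i => ?_⟩ : Space.mk w (Punctured.ofVec x) = _).symm
    by_cases hi : x.1 i = 0
    · simp [Punctured.ofVec, hi]
    · have hdiv : g * (w i / g) = w i := Nat.mul_div_cancel' (Finset.gcd_dvd ((hmem i).2 hi))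
      simp only [Punctured.ofVec, map_mul, map_pow, Units.val_mk0]
      rw [← ht, ← pow_mul, hdiv]

variable [Fintype F]

theorem exists_algebraMap_eq_of_pow_card_eq {a : AlgebraicClosure F}
    (ha : a ^ Fintype.card F = a) : ∃ b : F, algebraMap F (AlgebraicClosure F) b = a := by
  classical
  set p : Polynomial (AlgebraicClosure F) :=
    Polynomial.X ^ Fintype.card F - Polynomial.X with hp
  have hp0 : p ≠ 0 := FiniteField.X_pow_card_sub_X_ne_zero _ Fintype.one_lt_card
  have hroot : ∀ x : AlgebraicClosure F, x ∈ p.roots.toFinset ↔ x ^ Fintype.card F = x := by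
    intro x
    rw [Multiset.mem_toFinset, Polynomial.mem_roots hp0]
    simp [hp, sub_eq_zero]
  -- The elements of `F` are already `q` roots of `X ^ q - X`.
  have himage : Finset.univ.image (algebraMap F (AlgebraicClosure F)) = p.roots.toFinset := by
    refine Finset.eq_of_subset_of_card_le (fun x hx => ?_) ?_
    · obtain ⟨b, -, rfl⟩ := Finset.mem_image.1 hx
      rw [hroot, ← map_pow, FiniteField.pow_card]
    · rw [Finset.card_image_of_injective _ (algebraMap F (AlgebraicClosure F)).injective,
        Finset.card_univ]
      refine (Multiset.toFinset_card_le _).trans ((Polynomial.card_roots' p).trans ?_)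
      exact (FiniteField.X_pow_card_sub_X_natDegree_eq _ Fintype.one_lt_card).le
  obtain ⟨b, -, hb⟩ := Finset.mem_image.1 (himage ▸ (hroot a).2 ha)
  exact ⟨b, hb⟩

/-- Every rational point has homogeneous coordinates in `F` (Hilbert 90 for the scalar by which
Frobenius acts on a representative). -/
theorem exists_rep_of_mem_rationalPoints {w : Fin (m + 1) → ℕ} {P : Space F w}
    (hP : P ∈ rationalPoints F w) :
    ∃ x : {x : Fin (m + 1) → F // x ≠ 0}, Space.mk w (Punctured.ofVec x) = P := by
  have hq1 : 1 < Fintype.card F := Fintype.one_lt_card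
  induction P using Quotient.inductionOn with
  | h x =>
    obtain ⟨t, ht⟩ := Quotient.exact (show Space.mk w (frobVec x) = Space.mk w x from hP)
    obtain ⟨s, hs⟩ := IsAlgClosed.exists_pow_nat_eq (t : AlgebraicClosure F)
      (show 0 < Fintype.card F - 1 by omega)
    have hs0 : s ≠ 0 := by
      rintro rfl
      rw [zero_pow (by omega)] at hs
      exact t.ne_zero hs.symm
    have hsq : s ^ Fintype.card F = t * s := by
      rw [← hs, ← pow_succ]
      congr 1
      omega
    have key : ∀ i, (s ^ w i * x.1 i) ^ Fintype.card F = s ^ w i * x.1 i := fun i => by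
      have h : x.1 i = (t : AlgebraicClosure F) ^ w i * x.1 i ^ Fintype.card F := ht i
      rw [mul_pow, pow_right_comm, hsq, mul_pow]
      conv_rhs => rw [h]
      ring
    choose y hy using fun i => exists_algebraMap_eq_of_pow_card_eq (key i)
    refine ⟨⟨y, fun h => x.2 <| funext fun i => ?_⟩, ?_⟩
    · have := hy i
      rw [h] at this
      simpa [hs0] using this.symm
    · exact (Quotient.sound ⟨Units.mk0 s hs0, fun i => hy i⟩ : Space.mk w x = _).symm

theorem mul_ncard_rationalZeros_le {w : Fin (m + 1) → ℕ} (hw : ∀ i, 1 ≤ w i)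
    (f : MvPolynomial (Fin (m + 1)) F) :
    (Fintype.card F - 1) * (rationalZeros w f).ncard ≤
      Nat.card {x : {x : Fin (m + 1) → F // x ≠ 0} // eval x.1 f = 0} := by
  choose ρ hρ using fun P : rationalZeros w f => exists_rep_of_mem_rationalPoints P.2.1
  choose j hj hjρ using exists_injective_rep (F := F) hw
  have hcard : Nat.card (Fˣ × rationalZeros w f) =
      (Fintype.card F - 1) * (rationalZeros w f).ncard := by
    rw [Nat.card_prod, Nat.card_units, Nat.card_eq_fintype_card, Nat.card_coe_set_eq]
  have hmk : ∀ y : Fˣ × rationalZeros w f,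
      Space.mk w (Punctured.ofVec (j (ρ y.2) y.1)) = y.2.1 := fun y => (hjρ _ _).trans (hρ _)
  rw [← hcard]
  refine Nat.card_le_card_of_injective (fun y => ⟨j (ρ y.2) y.1, ?_⟩) ?_
  · have := y.2.2.2 _ (hmk y)
    rwa [aeval_ofVec, map_eq_zero] at this
  · rintro ⟨ξ, P⟩ ⟨ξ', P'⟩ h
    have h' := Subtype.ext_iff.1 h
    obtain rfl : P = P' := Subtype.ext (by
      rw [← hmk (ξ, P), ← hmk (ξ', P')]
      exact congrArg (fun z => Space.mk w (Punctured.ofVec z)) h')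
    exact Prod.ext (hj _ h') rfl

theorem mul_ncard_rationalZeros_add_one_le {w : Fin (m + 1) → ℕ} (hw : ∀ i, 1 ≤ w i) {d : ℕ}
    (hd : 0 < d) {f : MvPolynomial (Fin (m + 1)) F} (hf : IsWeightedHomogeneous w f d) :
    (Fintype.card F - 1) * (rationalZeros w f).ncard + 1 ≤ (affineZeros f).card := by
  classical
  have hzero : (0 : Fin (m + 1) → F) ∈ affineZeros f := by
    rw [mem_affineZeros, eval_zero, constantCoeff_eq]
    exact hf.coeff_eq_zero _ (by simpa using hd.ne)
  rw [← Finset.card_erase_add_one hzero, Nat.add_le_add_iff_right]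
  refine (mul_ncard_rationalZeros_le hw f).trans ?_
  rw [← Nat.card_eq_finsetCard]
  refine Nat.card_le_card_of_injective (fun y => ⟨y.1.1, ?_⟩) fun y z h => ?_
  · rw [Finset.mem_erase, mem_affineZeros]
    exact ⟨y.1.2, y.2⟩
  · exact Subtype.ext (Subtype.ext (congrArg (fun z => z.1) h))

theorem rationalZeros_eq_empty {w : Fin (m + 1) → ℕ} (hw : ∀ i, 1 ≤ w i)
    {f : MvPolynomial (Fin (m + 1)) F} (hf : IsWeightedHomogeneous w f 0) (hf0 : f ≠ 0) :
    rationalZeros w f = ∅ := by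
  have hC : f = C (coeff 0 f) := by
    rw [← weightedHomogeneousComponent_zero f fun i => Nat.one_le_iff_ne_zero.1 (hw i),
      hf.weightedHomogeneousComponent_same]
  refine Set.eq_empty_of_forall_notMem fun P hP => ?_
  obtain ⟨x, hx⟩ := exists_rep_of_mem_rationalPoints hP.1
  have := hP.2 _ hx
  rw [aeval_ofVec, map_eq_zero, hC, eval_C] at this
  rw [this, C_0] at hC
  exact hf0 hC

theorem projCard_natCast_sub_one (q k : ℕ) :
    projCard q ((k : ℤ) - 1) = ((q : ℚ) ^ k - 1) / ((q : ℚ) - 1) := by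
  rw [projCard, sub_add_cancel, zpow_natCast]

/-- The integer `⌊(d - 1) / v⌋ + 1` is `⌈d / v⌉`; it is `0` when `d = 0`, the floor being `-1`. -/
theorem exists_natCast_eq_floor_add_one (d : ℕ) {v : ℕ} (hv : 1 ≤ v) :
    ∃ D : ℕ, (D : ℚ) = (⌊((d : ℚ) - 1) / (v : ℚ)⌋ : ℚ) + 1 ∧ d ≤ v * D := by
  have hv0 : (0 : ℚ) < v := by exact_mod_cast hv
  obtain ⟨D, hD⟩ : ∃ D : ℕ, (D : ℤ) = ⌊((d : ℚ) - 1) / (v : ℚ)⌋ + 1 := by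
    refine ⟨(⌊((d : ℚ) - 1) / (v : ℚ)⌋ + 1).toNat, Int.toNat_of_nonneg ?_⟩
    have : (-1 : ℤ) ≤ ⌊((d : ℚ) - 1) / (v : ℚ)⌋ := by
      rw [Int.le_floor, le_div_iff₀ hv0]
      have h1 : (1 : ℚ) ≤ v := by exact_mod_cast hv
      have h2 : (0 : ℚ) ≤ d := Nat.cast_nonneg d
      push_cast
      linarith
    omega
  have hDq : (D : ℚ) = (⌊((d : ℚ) - 1) / (v : ℚ)⌋ : ℚ) + 1 := by exact_mod_cast hD
  refine ⟨D, hDq, ?_⟩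
  have h := Int.lt_floor_add_one (((d : ℚ) - 1) / (v : ℚ))
  rw [← hDq, div_lt_iff₀ hv0, sub_lt_iff_lt_add] at h
  rw [mul_comm]
  exact Nat.lt_succ_iff.1 (by exact_mod_cast h)

theorem pow_sub_one_div_nonneg {q : ℚ} (hq : 1 < q) (k : ℕ) : 0 ≤ (q ^ k - 1) / (q - 1) :=
  div_nonneg (sub_nonneg.2 (one_le_pow₀ hq.le)) (sub_pos.2 hq).le

theorem ncard_rationalZeros_le {n : ℕ} {w : Fin (n + 2) → ℕ} (hpos : ∀ i, 1 ≤ w i)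
    (hw : ∀ i : Fin (n + 1), w 1 ≤ w i.succ) {d D : ℕ} (hdD : d ≤ w 1 * D)
    {f : MvPolynomial (Fin (n + 2)) F} (hf : IsWeightedHomogeneous w f d) (hf0 : f ≠ 0) :
    ((rationalZeros w f).ncard : ℚ) ≤
      min (((Fintype.card F : ℚ) ^ (n + 2) - 1) / ((Fintype.card F : ℚ) - 1))
        (D * (Fintype.card F : ℚ) ^ n +
          ((Fintype.card F : ℚ) ^ n - 1) / ((Fintype.card F : ℚ) - 1)) := by
  have hq1 : (1 : ℚ) < Fintype.card F := by exact_mod_cast Fintype.one_lt_card (α := F)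
  have hq0 : (0 : ℚ) < (Fintype.card F : ℚ) - 1 := sub_pos.2 hq1
  obtain rfl | hd := Nat.eq_zero_or_pos d
  · rw [rationalZeros_eq_empty hpos hf hf0, Set.ncard_empty, Nat.cast_zero]
    exact le_min (pow_sub_one_div_nonneg hq1 _)
      (add_nonneg (by positivity) (pow_sub_one_div_nonneg hq1 _))
  have hcast : ((Fintype.card F - 1 : ℕ) : ℚ) = (Fintype.card F : ℚ) - 1 := by
    rw [Nat.cast_sub Fintype.card_pos, Nat.cast_one]
  have hN := mul_ncard_rationalZeros_add_one_le hpos hd hf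
  have hA := card_affineZeros_le_of_isWeightedHomogeneous (hpos 1) (hpos 0) hw hdD hf hf0
  rw [pow_succ', mul_assoc] at hA
  have hB := hN.trans (le_of_mul_le_mul_left hA Fintype.card_pos)
  have hT := hN.trans (card_affineZeros_le_pow f)
  have hB' : ((Fintype.card F : ℚ) - 1) * (rationalZeros w f).ncard + 1 ≤
      (Fintype.card F : ℚ) ^ n * (1 + ((Fintype.card F : ℚ) - 1) * D) := by
    rw [← hcast]
    exact_mod_cast hB
  have hT' : ((Fintype.card F : ℚ) - 1) * (rationalZeros w f).ncard + 1 ≤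
      (Fintype.card F : ℚ) ^ (n + 2) := by
    rw [← hcast]
    exact_mod_cast hT
  refine le_min ?_ ?_
  · rw [le_div_iff₀ hq0]
    linarith
  · rw [← sub_le_iff_le_add', le_div_iff₀ hq0]
    linarith

end RationalPoints

end WeightedProj

theorem proposition4p6 (F : Type*) [Field F] [Fintype F] (m : ℕ) (hm : 1 ≤ m)
    (w : Fin (m + 1) → ℕ) (hpos : ∀ i, 1 ≤ w i)
    (hmono : ∀ i j : Fin (m + 1), 1 ≤ i → i ≤ j → w i ≤ w j)
    (hgcd : ∀ i : Fin (m + 1), 1 ≤ i →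
      Nat.gcd (Nat.gcd (w 0) (w i)) (Fintype.card F - 1) = 1)
    (d : ℕ) :
    (WeightedProj.maxZeros F d w : ℚ) ≤
      min (WeightedProj.projCard (Fintype.card F) (m : ℤ))
        (((⌊((d : ℚ) - 1) / (w 1 : ℚ)⌋ : ℤ) + 1 : ℚ) * (Fintype.card F : ℚ) ^ (m - 1) +
          WeightedProj.projCard (Fintype.card F) ((m : ℤ) - 2)) := by
  obtain ⟨n, rfl⟩ : ∃ n, m = n + 1 := ⟨m - 1, by omega⟩
  have hw : ∀ i : Fin (n + 1), w 1 ≤ w i.succ := fun i =>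
    hmono 1 i.succ le_rfl (Fin.succ_le_succ_iff.2 (Fin.zero_le i))
  obtain ⟨D, hD, hdD⟩ := WeightedProj.exists_natCast_eq_floor_add_one d (hpos 1)
  have hq1 : (1 : ℚ) < Fintype.card F := by exact_mod_cast Fintype.one_lt_card (α := F)
  rw [show ((n + 1 : ℕ) : ℤ) = ((n + 2 : ℕ) : ℤ) - 1 by push_cast; ring,
    show ((n + 2 : ℕ) : ℤ) - 1 - 2 = (n : ℤ) - 1 by push_cast; ring,
    WeightedProj.projCard_natCast_sub_one, WeightedProj.projCard_natCast_sub_one,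
    Nat.add_sub_cancel, ← hD]
  by_cases hne : weightedHomogeneousSubmodule F w d = ⊥
  · have hempty : WeightedProj.zeroCounts F d w = ∅ := by
      refine Set.eq_empty_of_forall_notMem ?_
      rintro N ⟨f, hf, hf0, -⟩
      rw [hne] at hf
      exact hf0 ((Submodule.mem_bot F).1 hf)
    rw [WeightedProj.maxZeros, hempty, csSup_empty, Nat.bot_eq_zero, Nat.cast_zero]
    exact le_min (WeightedProj.pow_sub_one_div_nonneg hq1 _)
      (add_nonneg (by positivity) (WeightedProj.pow_sub_one_div_nonneg hq1 _))
  · obtain ⟨f, hf, hf0, hN⟩ := (WeightedProj.isGreatest_maxZeros F d w hne).1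
    rw [hN]
    exact WeightedProj.ncard_rationalZeros_le hpos hw hdD hf hf0
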